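/- Let $p$ be a prime and let $R$ be a reduced Noetherian ring of characteristic $p$ that is F-finite, i.e. finitely generated as a module over its subring $R^p$ of $p$-th powers. Notation, for any ring $A$ of characteristic $p$ (the zero ring being allowed as a localization). For $e\in\mathbb N$ let $A^{1/p^e}$ (also written $F^e_*A$) be the $A$-module whose elements are written $x^{1/p^e}$ with $x\in A$, which as an abelian group is a copy of $A$, with $r\cdot x^{1/p^e}=(r^{p^e}x)^{1/p^e}$. An ideal $J$ of $A$ is *uniformly F-compatible* if $\varphi(x^{1/p^e})\in J$ for all $e\in\mathbb N$, all $\varphi\in\operatorname{Hom}_A(A^{1/p^e},A)$ and all $x\in J$. The *test ideal* $\tau(A)$ is the smallest uniformly F-compatible ideal of $A$ that is not contained in any minimal prime of $A$, if a smallest one exists. The ring $A$ is *(strongly) F-regular* if for every $f\in A$ not in any minimal prime there are $e\in\mathbb N$ and $\varphi\in\operatorname{Hom}_A(A^{1/p^e},A)$ with $\varphi(f^{1/p^e})=1$. Then the test ideal $\tau(R)$ exists, and: 1. For every multiplicative set $U\subseteq R$ the test ideal of $RU^{-1}$ exists and $\tau(RU^{-1})=\tau(R)\,RU^{-1}$.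 For every prime $\mathfrak p$ of $R$, the test ideal of the completion $\widehat{R_{\mathfrak p}}$ of $R_{\mathfrak p}$ at its maximal ideal exists and $\tau(\widehat{R_{\mathfrak p}})=\tau(R)\,\widehat{R_{\mathfrak p}}$. 2. $R$ is F-regular if and only if $\tau(R)=R$. 3. For every prime $\mathfrak p$ of $R$: $\tau(R)\subseteq\mathfrak p$ if and only if $R_{\mathfrak p}$ is not F-regular; that is, $\tau(R)$ defines the closed locus of primes at which $R$ fails to be F-regular. 4. For every $c\in R$, the ideal generated by all elements $\varphi(c^{1/p^e})$, with $e\in\mathbb N$ and $\varphi\in\operatorname{Hom}_R(R^{1/p^e},R)$, is uniformly F-compatible. There is an element $c\in\tau(R)$ that lies in no minimal prime of $R$, and for every such $c$ the elements $\varphi(c^{1/p^e})$ generate $\tau(R)$. -/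

import Mathlib

/-!
Throughout, `R` is an algebra over the prime field `ZMod p`; a ring of characteristic `p` is the
same thing as a nonzero `ZMod p`-algebra, and the algebra structure is unique.  Working with
algebras makes sense of everything for localizations that happen to be zero as well.
-/

/-- The `e`-th iterate of Frobenius, `r ↦ r ^ (p ^ e)`, as a ring homomorphism. -/
def frobIter (p : ℕ) [Fact p.Prime] (e : ℕ) (R : Type*) [CommRing R] [Algebra (ZMod p) R] :
    R →+* R where
  toFun r := r ^ p ^ e
  map_one' := one_pow _
  map_mul' r s := mul_pow r s _
  map_zero' := zero_pow (pow_ne_zero _ (Fact.out : p.Prime).ne_zero)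
  map_add' r s := by
    rcases subsingleton_or_nontrivial R with h | h
    · exact Subsingleton.elim _ _
    · have : CharP R p :=
        charP_of_injective_algebraMap (algebraMap (ZMod p) R).injective p
      exact add_pow_char_pow r s p e

/-- `R` is F-finite: it is a finitely generated module over its subring `R ^ p` of `p`-th powers. -/
def IsFFinite (p : ℕ) [Fact p.Prime] (R : Type*) [CommRing R] [Algebra (ZMod p) R] : Prop :=
  Module.Finite (frobIter p 1 R).range R

/-- The `R`-module `R^{1/p^e}` (also written `F^e_* R`): as an additive group it is a copy of `R`,
whose elements are written `x^{1/p^e}` with `x` in `R`, and `r • x^{1/p^e} = (r^{p^e} x)^{1/p^e}`. -/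
def FrobRoot (_p _e : ℕ) (R : Type*) : Type _ := R

instance FrobRoot.instAddCommGroup (p e : ℕ) (R : Type*) [CommRing R] :
    AddCommGroup (FrobRoot p e R) :=
  inferInstanceAs (AddCommGroup R)

instance FrobRoot.instModule (p : ℕ) [Fact p.Prime] (e : ℕ) (R : Type*) [CommRing R]
    [Algebra (ZMod p) R] : Module R (FrobRoot p e R) :=
  (Module.compHom R (frobIter p e R) : Module R R)

/-- The additive bijection `x ↦ x^{1/p^e}` from `R` onto `R^{1/p^e}`. -/
def FrobRoot.root (p e : ℕ) {R : Type*} [CommRing R] : R ≃+ FrobRoot p e R :=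
  AddEquiv.refl R

theorem FrobRoot.smul_root (p : ℕ) [Fact p.Prime] (e : ℕ) {R : Type*} [CommRing R]
    [Algebra (ZMod p) R] (r x : R) :
    r • FrobRoot.root p e x = FrobRoot.root p e (r ^ p ^ e * x) :=
  rfl

/-- An ideal `J` is uniformly F-compatible if `φ(J^{1/p^e}) ⊆ J` for all `e` and all `R`-linear maps
`φ : R^{1/p^e} → R`. -/
def IsUniformlyFCompatible (p : ℕ) [Fact p.Prime] {R : Type*} [CommRing R] [Algebra (ZMod p) R]
    (J : Ideal R) : Prop :=
  ∀ (e : ℕ) (φ : FrobRoot p e R →ₗ[R] R), ∀ x ∈ J, φ (FrobRoot.root p e x) ∈ J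

/-- `τ` is the test ideal of `R`: the smallest uniformly F-compatible ideal that is not contained in
any minimal prime of `R`. -/
def IsTestIdeal (p : ℕ) [Fact p.Prime] {R : Type*} [CommRing R] [Algebra (ZMod p) R]
    (τ : Ideal R) : Prop :=
  IsLeast {J : Ideal R | IsUniformlyFCompatible p J ∧ ∀ P ∈ minimalPrimes R, ¬ J ≤ P} τ

/-- (Strong) F-regularity: for every `f` not in any minimal prime of `R` there are `e` and an
`R`-linear map `φ : R^{1/p^e} → R` with `φ(f^{1/p^e}) = 1`. -/
def IsFRegular (p : ℕ) [Fact p.Prime] (R : Type*) [CommRing R] [Algebra (ZMod p) R] : Prop :=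
  ∀ f : R, (∀ P ∈ minimalPrimes R, f ∉ P) →
    ∃ (e : ℕ) (φ : FrobRoot p e R →ₗ[R] R), φ (FrobRoot.root p e f) = 1

/-- The ideal generated by all `φ(c^{1/p^e})`, over all `e` and all `R`-linear
`φ : R^{1/p^e} → R`. -/
def frobTraceIdeal (p : ℕ) [Fact p.Prime] {R : Type*} [CommRing R] [Algebra (ZMod p) R]
    (c : R) : Ideal R :=
  Ideal.span {y : R | ∃ (e : ℕ) (φ : FrobRoot p e R →ₗ[R] R), y = φ (FrobRoot.root p e c)}

/-- The completion of the local ring `R_P` at its maximal ideal. -/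
abbrev LocalCompletion {R : Type*} [CommRing R] (P : Ideal R) [P.IsPrime] : Type _ :=
  AdicCompletion (IsLocalRing.maximalIdeal (Localization.AtPrime P)) (Localization.AtPrime P)

/-! Everything rests on one nonzerodivisor `c`: up to the denominator `c`, the module `A^{1/p}` has
a finite dual basis and `A` is F-split. Over the total ring of fractions, a product of fields, both
hold with no denominator, and F-finiteness lets denominators be cleared
(`exists_isFrobSplittingElement`).

Let `J` be uniformly F-compatible and contain a nonzerodivisor `d`. Away from `c` the dual bases
force `d` into the Frobenius powers of `J`, hence into ever higher powers of any prime containing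
`J`. Krull's intersection theorem then shows that no such prime misses `c`, so `c ∈ rad J`
(`mem_radical`). The map with `φ(1) = c` lowers the exponent of `c` to 3 (`cube_mem_of_pow_mem`),
independently of `J`. So `c ^ 3` lies in every competitor, and its trace ideal is the test ideal.

If `τ = A`, the trace ideal of 1 restricted to exponents `e ≥ 1` is also the unit ideal, which makes
`A` F-split; splitting then brings a sum of values of maps with different `e` to a common exponent
(`isFRegular_iff`).

For a flat `A → B` along which maps extend and `A^{1/p^e}` generates `B^{1/p^e}`, `c` keeps its
properties and trace ideals commute with base change. Localizations and completions are both of this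
kind. -/

section General

variable (p : ℕ) [Fact p.Prime]

/-! ### Operations on `p^{-e}`-linear maps -/

namespace FrobRoot

variable {A : Type*} [CommRing A] [Algebra (ZMod p) A]

/-- Build a linear map `A^{1/p^e} → A` from an additive `p^{-e}`-linear map `A → A`. -/
def linearMapMk (e : ℕ) (f : A →+ A) (hf : ∀ r x, f (r ^ p ^ e * x) = r * f x) :
    FrobRoot p e A →ₗ[A] A where
  toFun x := f ((root p e).symm x)
  map_add' x y := by simp
  map_smul' r x := hf r ((root p e).symm x)

variable {p}

theorem map_root_pow_mul {e : ℕ} (φ : FrobRoot p e A →ₗ[A] A) (r x : A) :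
    φ (root p e (r ^ p ^ e * x)) = r * φ (root p e x) := by
  rw [← smul_root, map_smul, smul_eq_mul]

variable (p) in
/-- The identity, as a linear map `A^{1/p^0} → A`. -/
def rootZero : FrobRoot p 0 A →ₗ[A] A :=
  linearMapMk p 0 (AddMonoidHom.id A) (by simp)

/-- The composite `A^{1/p^(d+e)} → A^{1/p^d} → A`, the first map being the `p^d`-th root of `ψ`. -/
def comp {d e : ℕ} (φ : FrobRoot p d A →ₗ[A] A) (ψ : FrobRoot p e A →ₗ[A] A) :
    FrobRoot p (d + e) A →ₗ[A] A :=
  linearMapMk p (d + e)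
    ((φ.toAddMonoidHom.comp (root p d).toAddMonoidHom).comp
      (ψ.toAddMonoidHom.comp (root p e).toAddMonoidHom))
    (fun r x => by
      change φ (root p d (ψ (root p e (r ^ p ^ (d + e) * x)))) = _
      rw [pow_add, pow_mul, map_root_pow_mul, map_root_pow_mul]
      rfl)

theorem comp_root {d e : ℕ} (φ : FrobRoot p d A →ₗ[A] A) (ψ : FrobRoot p e A →ₗ[A] A) (x : A) :
    comp φ ψ (root p (d + e) x) = φ (root p d (ψ (root p e x))) :=
  rfl

/-- Precomposition of `φ` with multiplication by `a^{1/p^e}`. -/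
def mulRight {e : ℕ} (φ : FrobRoot p e A →ₗ[A] A) (a : A) : FrobRoot p e A →ₗ[A] A :=
  linearMapMk p e ((φ.toAddMonoidHom.comp (root p e).toAddMonoidHom).comp (AddMonoidHom.mulLeft a))
    (fun r x => by
      change φ (root p e (a * (r ^ p ^ e * x))) = _
      rw [mul_left_comm, map_root_pow_mul]
      rfl)

theorem mulRight_root {e : ℕ} (φ : FrobRoot p e A →ₗ[A] A) (a x : A) :
    mulRight φ a (root p e x) = φ (root p e (a * x)) :=
  rfl

/-- The restriction of `φ : A^{1/p^(d+e)} → A` to `A^{1/p^d}`. -/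
def restrict {d : ℕ} (e : ℕ) (φ : FrobRoot p (d + e) A →ₗ[A] A) : FrobRoot p d A →ₗ[A] A :=
  linearMapMk p d ((φ.toAddMonoidHom.comp (root p (d + e)).toAddMonoidHom).comp
      (frobIter p e A).toAddMonoidHom)
    (fun r x => by
      change φ (root p (d + e) ((r ^ p ^ d * x) ^ p ^ e)) = _
      rw [mul_pow, ← pow_mul, ← pow_add, map_root_pow_mul]
      rfl)

theorem restrict_root {d : ℕ} (e : ℕ) (φ : FrobRoot p (d + e) A →ₗ[A] A) (x : A) :
    restrict e φ (root p d x) = φ (root p (d + e) (x ^ p ^ e)) :=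
  rfl

end FrobRoot

open FrobRoot

variable {p} {A : Type*} [CommRing A] [Algebra (ZMod p) A]

/-! ### Trace ideals and minimal primes -/

theorem map_root_mem_of_mem_span {e : ℕ} (φ : FrobRoot p e A →ₗ[A] A) {S : Set A} {J : Ideal A}
    (h : ∀ a, ∀ s ∈ S, φ (root p e (a * s)) ∈ J) {x : A} (hx : x ∈ Ideal.span S) :
    φ (root p e x) ∈ J := by
  suffices H : ∀ a, φ (root p e (a * x)) ∈ J by simpa using H 1
  induction hx using Submodule.span_induction with
  | mem y hy => exact fun a => h a y hy
  | zero => intro a; simp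
  | add y z _ _ hy hz => intro a; rw [mul_add, map_add, map_add]; exact J.add_mem (hy a) (hz a)
  | smul b y _ hy => intro a; simpa [mul_assoc] using hy (a * b)

/-- The ideal generated by the `φ(c^{1/p^e})` with `e` at least `m`. -/
def frobTraceIdealFrom (p : ℕ) [Fact p.Prime] {A : Type*} [CommRing A] [Algebra (ZMod p) A]
    (m : ℕ) (c : A) : Ideal A :=
  Ideal.span {y : A | ∃ (e : ℕ) (φ : FrobRoot p e A →ₗ[A] A), m ≤ e ∧ y = φ (root p e c)}

/-- Composing a map with a multiple of another one adds the exponents, so the result is again one of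
the maps that define the ideal. -/
theorem isUniformlyFCompatible_frobTraceIdealFrom (m : ℕ) (c : A) :
    IsUniformlyFCompatible p (frobTraceIdealFrom p m c) := by
  intro e φ x hx
  refine map_root_mem_of_mem_span φ ?_ hx
  rintro a _ ⟨d, ψ, hd, rfl⟩
  exact Ideal.subset_span ⟨e + d, comp (mulRight φ a) ψ, by omega, rfl⟩

theorem frobTraceIdealFrom_zero (c : A) : frobTraceIdealFrom p 0 c = frobTraceIdeal p c := by
  simp [frobTraceIdealFrom, frobTraceIdeal]

theorem isUniformlyFCompatible_frobTraceIdeal (c : A) :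
    IsUniformlyFCompatible p (frobTraceIdeal p c) :=
  frobTraceIdealFrom_zero (p := p) c ▸ isUniformlyFCompatible_frobTraceIdealFrom 0 c

theorem self_mem_frobTraceIdeal (c : A) : c ∈ frobTraceIdeal p c :=
  Ideal.subset_span ⟨0, rootZero p, rfl⟩

theorem frobTraceIdeal_le {J : Ideal A} (hJ : IsUniformlyFCompatible p J) {c : A} (hc : c ∈ J) :
    frobTraceIdeal p c ≤ J :=
  Ideal.span_le.2 (by rintro _ ⟨e, φ, rfl⟩; exact hJ e φ c hc)

theorem frobTraceIdealFrom_le (m : ℕ) (c : A) : frobTraceIdealFrom p m c ≤ frobTraceIdeal p c :=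
  Ideal.span_mono (by rintro _ ⟨e, φ, -, rfl⟩; exact ⟨e, φ, rfl⟩)

/-- In a reduced ring an element is in no minimal prime iff it is a nonzerodivisor. -/
theorem mem_nonZeroDivisors_iff_forall_notMem_minimalPrimes {A : Type*} [CommRing A] [IsReduced A]
    {d : A} : d ∈ nonZeroDivisors A ↔ ∀ P ∈ minimalPrimes A, d ∉ P := by
  refine ⟨fun h P hP hd => notMem_nonZeroDivisors_of_mem_mem_minimalPrimes hd hP h, fun h => ?_⟩
  by_contra hd
  rw [mem_nonZeroDivisors_iff_right] at hd
  push Not at hd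
  obtain ⟨y, hy, hy0⟩ := hd
  have : d ∈ ⋃ P ∈ (⊥ : Ideal A).minimalPrimes, (P : Set A) := by
    rw [Ideal.iUnion_minimalPrimes]
    have hn : (⊥ : Ideal A).radical = ⊥ := nilradical_eq_zero A
    refine ⟨y, ?_, ?_⟩
    · simpa [hn] using hy0
    · rw [mul_comm, hy]; exact Ideal.zero_mem _
  simp only [Set.mem_iUnion] at this
  obtain ⟨P, hP, hdP⟩ := this
  exact h P hP hdP

/-- An ideal of a Noetherian ring in no minimal prime has an element in no minimal prime. -/
theorem exists_mem_forall_notMem_minimalPrimes {A : Type*} [CommRing A] [IsNoetherianRing A]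
    {J : Ideal A} (hJ : ∀ P ∈ minimalPrimes A, ¬ J ≤ P) :
    ∃ d ∈ J, ∀ P ∈ minimalPrimes A, d ∉ P := by
  by_contra! h
  have hfin := minimalPrimes.finite_of_isNoetherianRing A
  have hsub : (J : Set A) ⊆ ⋃ P ∈ (hfin.toFinset : Set (Ideal A)), ((id P : Ideal A) : Set A) := by
    intro d hd
    obtain ⟨P, hP, hdP⟩ := h d hd
    simp only [Set.mem_iUnion]
    exact ⟨P, by simpa using hP, hdP⟩
  obtain ⟨P, hP, hle⟩ := (Ideal.subset_union_prime (f := id) ⊥ ⊥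
    (fun P hP _ _ => (by simpa using hP : P ∈ minimalPrimes A).1.1)).1 hsub
  exact hJ P (by simpa using hP) hle

/-! ### Splitting elements and existence of the test ideal -/

variable (p) in
/-- A nonzerodivisor `c` after whose inversion `A^{1/p}` becomes projective and `A` becomes a
direct summand of `A^{1/p}`, as witnessed by maps with denominator `c`. -/
structure IsFrobSplittingElement (c : A) : Prop where
  mem_nonZeroDivisors : c ∈ nonZeroDivisors A
  exists_map_one : ∃ φ : FrobRoot p 1 A →ₗ[A] A, φ (root p 1 1) = c
  exists_dualBasis : ∃ (n : ℕ) (b : Fin n → FrobRoot p 1 A) (φ : Fin n → FrobRoot p 1 A →ₗ[A] A),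
    ∀ x, c • x = ∑ i, φ i x • b i

namespace IsFrobSplittingElement

variable {c : A} (hc : IsFrobSplittingElement p c)
include hc

/-- If `x ^ p = 0`, then `0 = φ(x ^ p) = x φ(1) = x c`. -/
theorem isReduced : IsReduced A := by
  rw [isReduced_iff_pow_one_lt p (Fact.out : p.Prime).one_lt]
  intro x hx
  obtain ⟨φ, hφ⟩ := hc.exists_map_one
  have := map_root_pow_mul φ x 1
  rw [pow_one, hx, zero_mul, map_zero, map_zero, hφ] at this
  exact (mem_nonZeroDivisors_iff_right.1 hc.mem_nonZeroDivisors) x this.symm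

/-- The dual basis recovers `x`, up to a power of `c`, from the values of maps at `x`. These values
enter as `p^e`-th powers, so membership in `J` is amplified. -/
theorem pow_mul_mem_pow (J : Ideal A) (e : ℕ) :
    ∃ k, ∀ x : A, (∀ φ : FrobRoot p e A →ₗ[A] A, φ (root p e x) ∈ J) → c ^ k * x ∈ J ^ p ^ e := by
  induction e with
  | zero =>
    refine ⟨0, fun x hx => ?_⟩
    rw [pow_zero, pow_zero, pow_one, one_mul]
    exact hx (rootZero p)
  | succ e ih =>
    obtain ⟨k, hk⟩ := ih
    obtain ⟨n, b, φ, hb⟩ := hc.exists_dualBasis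
    -- The factor `c ^ p` expands `x` as `∑ φ i (x) ^ p * b i`; the factor `(c ^ k) ^ p` goes inside
    -- the `p`-th powers, where induction applies to each `φ i (x)`.
    refine ⟨k * p + p, fun x hx => ?_⟩
    have hx' : c ^ p * x = ∑ i, φ i (root p 1 x) ^ p * (root p 1).symm (b i) := by
      have h := congrArg (root p 1).symm (hb (root p 1 x))
      rw [map_sum] at h
      refine Eq.trans (b := c ^ p ^ 1 * x) (by rw [pow_one]) (h.trans ?_)
      refine Finset.sum_congr rfl fun i _ => ?_
      rw [← (root p 1).apply_symm_apply (b i), smul_root, pow_one]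
      rfl
    rw [pow_add c, mul_assoc, hx', Finset.mul_sum]
    refine Ideal.sum_mem _ fun i _ => ?_
    rw [pow_mul, ← mul_assoc, ← mul_pow, pow_succ p e, pow_mul]
    refine Ideal.mul_mem_right _ _ (Ideal.pow_mem_pow (hk _ fun ψ => ?_) p)
    exact hx (comp ψ (φ i))

theorem mem_radical [IsNoetherianRing A] {d : A} (hd : d ∈ nonZeroDivisors A) {J : Ideal A}
    (hJ : frobTraceIdealFrom p 1 d ≤ J) : c ∈ J.radical := by
  rw [Ideal.radical_eq_sInf, Ideal.mem_sInf]
  rintro P ⟨hJP, hP⟩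
  by_contra hcP
  let B := Localization.AtPrime P
  have hu : IsUnit (algebraMap A B c) := IsLocalization.map_units B (⟨c, hcP⟩ : P.primeCompl)
  -- Since `c` is a unit at `P`, its powers in the previous lemma can be dropped there.
  have hmem : algebraMap A B d ∈ ⨅ i, (IsLocalRing.maximalIdeal B) ^ i := by
    rw [Ideal.mem_iInf]
    intro i
    obtain ⟨k, hk⟩ := hc.pow_mul_mem_pow J (i + 1)
    have h1 : c ^ k * d ∈ P ^ p ^ (i + 1) := Ideal.pow_right_mono hJP _
      (hk d fun φ => hJ (Ideal.subset_span ⟨i + 1, φ, by omega, rfl⟩))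
    have h2 := Ideal.mem_map_of_mem (algebraMap A B) h1
    rw [Ideal.map_pow, Localization.AtPrime.map_eq_maximalIdeal, map_mul, map_pow,
      Ideal.unit_mul_mem_iff_mem _ (hu.pow k)] at h2
    refine Ideal.pow_le_pow_right ?_ h2
    exact le_trans (Nat.le_succ i) (Nat.lt_pow_self (Fact.out : p.Prime).one_lt).le
  rw [Ideal.iInf_pow_eq_bot_of_isLocalRing _ (IsLocalRing.maximalIdeal.isMaximal B).ne_top,
    Ideal.mem_bot] at hmem
  rw [IsLocalization.map_eq_zero_iff P.primeCompl] at hmem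
  obtain ⟨s, hs⟩ := hmem
  have : (s : A) = 0 := mem_nonZeroDivisors_iff_right.1 hd _ hs
  exact s.2 (this ▸ P.zero_mem)

/-- As `φ(c ^ (p m)) = c ^ m φ(1) = c ^ (m + 1)` with `m = ⌈N/2⌉`, the exponent `N` can be replaced
by `⌈N/2⌉ + 1`. This is smaller exactly when `N > 3`, whence the cube. -/
theorem cube_mem_of_pow_mem {J : Ideal A} (hJ : IsUniformlyFCompatible p J) (N : ℕ)
    (hN : c ^ N ∈ J) : c ^ 3 ∈ J := by
  induction N using Nat.strong_induction_on with
  | _ N ih =>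
    rcases Nat.lt_or_ge 3 N with h | h
    · obtain ⟨φ, hφ⟩ := hc.exists_map_one
      have hp := (Fact.out : p.Prime).two_le
      have hq : N ≤ p * ((N + 1) / 2) :=
        le_trans (by omega) (Nat.mul_le_mul_right ((N + 1) / 2) hp)
      refine ih ((N + 1) / 2 + 1) (by omega) ?_
      have := hJ 1 φ _ (J.mem_of_dvd (pow_dvd_pow c hq) hN)
      rw [mul_comm p, pow_mul] at this
      have h2 := map_root_pow_mul φ (c ^ ((N + 1) / 2)) 1
      rw [mul_one, pow_one, hφ, ← pow_succ] at h2
      rwa [h2] at this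
    · exact J.mem_of_dvd (pow_dvd_pow c h) hN

theorem cube_mem [IsNoetherianRing A] {J : Ideal A} (hJ : IsUniformlyFCompatible p J)
    (hJm : ∀ P ∈ minimalPrimes A, ¬ J ≤ P) : c ^ 3 ∈ J := by
  have := hc.isReduced
  obtain ⟨d, hdJ, hd⟩ := exists_mem_forall_notMem_minimalPrimes hJm
  rw [← mem_nonZeroDivisors_iff_forall_notMem_minimalPrimes] at hd
  obtain ⟨N, hN⟩ := hc.mem_radical hd
    ((frobTraceIdealFrom_le 1 d).trans (frobTraceIdeal_le hJ hdJ))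
  exact hc.cube_mem_of_pow_mem hJ N hN

theorem not_frobTraceIdealFrom_one_le [IsNoetherianRing A] {d : A} (hd : d ∈ nonZeroDivisors A) :
    ∀ P ∈ minimalPrimes A, ¬ frobTraceIdealFrom p 1 d ≤ P := by
  intro P hP hle
  have := hc.mem_radical hd hle
  rw [hP.1.1.radical] at this
  exact notMem_nonZeroDivisors_of_mem_mem_minimalPrimes this hP hc.mem_nonZeroDivisors

theorem isTestIdeal [IsNoetherianRing A] : IsTestIdeal p (frobTraceIdeal p (c ^ 3)) := by
  refine ⟨⟨isUniformlyFCompatible_frobTraceIdeal _, fun P hP hle => ?_⟩, ?_⟩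
  · exact notMem_nonZeroDivisors_of_mem_mem_minimalPrimes (hle (self_mem_frobTraceIdeal _)) hP
      (pow_mem hc.mem_nonZeroDivisors 3)
  · rintro J ⟨hJ, hJm⟩
    exact frobTraceIdeal_le hJ (hc.cube_mem hJ hJm)

end IsFrobSplittingElement

/-! ### F-splitting and F-regularity -/

/-- For an `F`-split ring the values at `x` of maps on `A^{1/p^d}` are also values at `x` of maps
on `A^{1/p^e}`, for every `e ≥ d`. -/
theorem exists_map_root_eq_of_le {d e : ℕ} (hde : d ≤ e) {ψ : FrobRoot p 1 A →ₗ[A] A}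
    (hψ : ψ (root p 1 1) = 1) (x : A) (φ : FrobRoot p d A →ₗ[A] A) :
    ∃ φ' : FrobRoot p e A →ₗ[A] A, φ' (root p e x) = φ (root p d x) := by
  induction e, hde using Nat.le_induction with
  | base => exact ⟨φ, rfl⟩
  | succ e _ ih =>
    obtain ⟨φ', h⟩ := ih
    -- The twisted splitting sends `x` to `ψ(x ^ p) = x`.
    refine ⟨comp φ' (mulRight ψ (x ^ (p - 1))), ?_⟩
    rw [← h, comp_root, mulRight_root, pow_sub_one_mul (Fact.out : p.Prime).ne_zero]
    have := map_root_pow_mul ψ x 1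
    rw [pow_one, mul_one, hψ, mul_one] at this
    rw [this]

/-- For an `F`-split ring, a unit trace ideal contains `1` as the value of a single map. -/
theorem exists_map_root_eq_one {ψ : FrobRoot p 1 A →ₗ[A] A} (hψ : ψ (root p 1 1) = 1) {x : A}
    (hx : frobTraceIdeal p x = ⊤) :
    ∃ (e : ℕ) (φ : FrobRoot p e A →ₗ[A] A), φ (root p e x) = 1 := by
  suffices H : ∀ y ∈ frobTraceIdeal p x,
      ∃ (e : ℕ) (φ : FrobRoot p e A →ₗ[A] A), φ (root p e x) = y from H 1 (hx ▸ trivial)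
  intro y hy
  induction hy using Submodule.span_induction with
  | mem y hy => obtain ⟨e, φ, rfl⟩ := hy; exact ⟨e, φ, rfl⟩
  | zero => exact ⟨0, 0, rfl⟩
  | add y z _ _ hy hz =>
    obtain ⟨e, φ, rfl⟩ := hy
    obtain ⟨e', φ', rfl⟩ := hz
    obtain ⟨χ, hχ⟩ := exists_map_root_eq_of_le (le_max_left e e') hψ x φ
    obtain ⟨χ', hχ'⟩ := exists_map_root_eq_of_le (le_max_right e e') hψ x φ'
    exact ⟨max e e', χ + χ', by rw [LinearMap.add_apply, hχ, hχ']⟩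
  | smul a y _ hy =>
    obtain ⟨e, φ, rfl⟩ := hy
    exact ⟨e, a • φ, rfl⟩

/-- Since 1 is its own `p`-th power, a map on `A^{1/p^e}` with `e ≥ 1` restricts to `A^{1/p}` with
the same value at 1, and maps with a common exponent can be added. -/
theorem exists_map_root_one_eq_of_mem {y : A} (hy : y ∈ frobTraceIdealFrom p 1 (1 : A)) :
    ∃ ψ : FrobRoot p 1 A →ₗ[A] A, ψ (root p 1 1) = y := by
  induction hy using Submodule.span_induction with
  | mem y hy =>
    obtain ⟨e, φ, he, rfl⟩ := hy
    obtain ⟨e, rfl⟩ := Nat.exists_eq_add_of_le he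
    exact ⟨restrict e φ, by rw [restrict_root, one_pow]⟩
  | zero => exact ⟨0, rfl⟩
  | add y z _ _ hy hz =>
    obtain ⟨φ, rfl⟩ := hy
    obtain ⟨φ', rfl⟩ := hz
    exact ⟨φ + φ', rfl⟩
  | smul a y _ hy =>
    obtain ⟨φ, rfl⟩ := hy
    exact ⟨a • φ, rfl⟩

theorem IsFrobSplittingElement.isFRegular_iff [IsNoetherianRing A] {c : A}
    (hc : IsFrobSplittingElement p c) {τ : Ideal A} (hτ : IsTestIdeal p τ) :
    IsFRegular p A ↔ τ = ⊤ := by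
  have := hc.isReduced
  constructor
  · intro h
    obtain ⟨e, φ, hφ⟩ := h (c ^ 3)
      (mem_nonZeroDivisors_iff_forall_notMem_minimalPrimes.1 (pow_mem hc.mem_nonZeroDivisors 3))
    rw [Ideal.eq_top_iff_one, ← hφ]
    exact hτ.1.1 e φ _ (hc.cube_mem hτ.1.1 hτ.1.2)
  · rintro rfl f hf
    have h1 : (⊤ : Ideal A) ≤ frobTraceIdealFrom p 1 1 :=
      hτ.2 ⟨isUniformlyFCompatible_frobTraceIdealFrom 1 1,
        hc.not_frobTraceIdealFrom_one_le (one_mem _)⟩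
    obtain ⟨ψ, hψ⟩ := exists_map_root_one_eq_of_mem (h1 (Submodule.mem_top (x := (1 : A))))
    refine exists_map_root_eq_one hψ (top_le_iff.1 (hτ.2 ⟨isUniformlyFCompatible_frobTraceIdeal f,
      fun P hP hle => hf P hP (hle (self_mem_frobTraceIdeal f))⟩))

theorem frobTraceIdeal_eq_of_isTestIdeal {τ : Ideal A} (hτ : IsTestIdeal p τ) {c : A} (hc : c ∈ τ)
    (hcm : ∀ P ∈ minimalPrimes A, c ∉ P) : frobTraceIdeal p c = τ :=
  le_antisymm (frobTraceIdeal_le hτ.1.1 hc)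
    (hτ.2 ⟨isUniformlyFCompatible_frobTraceIdeal c,
      fun P hP hle => hcm P hP (hle (self_mem_frobTraceIdeal c))⟩)

end General

/-! ### Existence of splitting elements over F-finite rings -/

section FFinite

open FrobRoot

variable {p : ℕ} [Fact p.Prime]

theorem FrobRoot.exists_generators_iff {A : Type*} [CommRing A] [Algebra (ZMod p) A] {e n : ℕ}
    (g : Fin n → A) : Submodule.span A (Set.range fun i => root p e (g i)) = ⊤ ↔
      ∀ x, ∃ a : Fin n → A, x = ∑ i, a i ^ p ^ e * g i := by
  rw [Submodule.eq_top_iff']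
  simp only [Submodule.mem_span_range_iff_exists_fun]
  constructor
  · intro h x
    obtain ⟨a, ha⟩ := h (root p e x)
    refine ⟨a, (root p e).injective ?_⟩
    rw [← ha, map_sum]
    rfl
  · intro h x
    obtain ⟨a, ha⟩ := h ((root p e).symm x)
    refine ⟨a, (root p e).symm.injective ?_⟩
    rw [ha, map_sum]
    rfl

theorem IsFFinite.finite_one {A : Type*} [CommRing A] [Algebra (ZMod p) A] (h : IsFFinite p A) :
    Module.Finite A (FrobRoot p 1 A) := by
  obtain ⟨n, s, hs⟩ := @Module.Finite.exists_fin _ _ _ _ _ h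
  have : Submodule.span A (Set.range fun i => root p 1 (s i)) = ⊤ := by
    rw [exists_generators_iff]
    intro x
    have hx : x ∈ Submodule.span (frobIter p 1 A).range (Set.range s) := hs ▸ trivial
    rw [Submodule.mem_span_range_iff_exists_fun] at hx
    obtain ⟨a, rfl⟩ := hx
    choose b hb using fun i => (a i).2
    refine ⟨b, Finset.sum_congr rfl fun i _ => ?_⟩
    rw [Subring.smul_def, smul_eq_mul, ← hb]
    rfl
  exact ⟨⟨(Set.finite_range _).toFinset, by simpa using this⟩⟩

theorem FrobRoot.finite {A : Type*} [CommRing A] [Algebra (ZMod p) A]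
    (h : Module.Finite A (FrobRoot p 1 A)) (e : ℕ) : Module.Finite A (FrobRoot p e A) := by
  induction e with
  | zero =>
    refine Module.Finite.of_surjective
      ({ toFun := root p 0, map_add' := map_add _, map_smul' := fun r x => ?_ } :
        A →ₗ[A] FrobRoot p 0 A) (root p 0).surjective
    simp [smul_root]
  | succ e ih =>
    obtain ⟨n, s, hs⟩ := @Module.Finite.exists_fin _ _ _ _ _ h
    obtain ⟨m, t, ht⟩ := @Module.Finite.exists_fin _ _ _ _ _ ih
    obtain ⟨s, rfl⟩ : ∃ s' : Fin n → A, s = fun i => root p 1 (s' i) :=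
      ⟨fun i => (root p 1).symm (s i), rfl⟩
    obtain ⟨t, rfl⟩ : ∃ t' : Fin m → A, t = fun i => root p e (t' i) :=
      ⟨fun i => (root p e).symm (t i), rfl⟩
    rw [exists_generators_iff] at hs ht
    have key : ⊤ ≤ Submodule.span A
        (Set.range fun ij : Fin n × Fin m => root p (e + 1) (t ij.2 ^ p * s ij.1)) := by
      intro x _
      obtain ⟨a, ha⟩ := hs ((root p (e + 1)).symm x)
      choose b hb using fun i => ht (a i)
      rw [Submodule.mem_span_range_iff_exists_fun]
      refine ⟨fun ij => b ij.1 ij.2, (root p (e + 1)).symm.injective ?_⟩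
      rw [ha, map_sum, Fintype.sum_prod_type]
      refine Finset.sum_congr rfl fun i _ => ?_
      have h1 : a i ^ p ^ 1 = ∑ j, (b i j ^ p ^ e * t j) ^ p ^ 1 := by
        rw [hb i]; exact map_sum (frobIter p 1 A) _ _
      rw [h1, Finset.sum_mul]
      refine Finset.sum_congr rfl fun j _ => ?_
      rw [smul_root, AddEquiv.symm_apply_apply, mul_pow, ← pow_mul, ← pow_add, pow_one, mul_assoc]
    exact ⟨⟨(Set.finite_range _).toFinset, by simpa using top_le_iff.1 key⟩⟩

/-- The total ring of fractions of a reduced Noetherian ring is semisimple. -/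
theorem isSemisimpleRing_localization_nonZeroDivisors (A : Type*) [CommRing A] [IsNoetherianRing A]
    [IsReduced A] : IsSemisimpleRing (Localization (nonZeroDivisors A)) := by
  let Q := Localization (nonZeroDivisors A)
  have : IsNoetherianRing Q :=
    IsLocalization.isNoetherianRing (nonZeroDivisors A) Q inferInstance
  -- By prime avoidance, a prime of `A` that contains only zerodivisors is minimal. Hence `Q` has
  -- dimension zero, and being Noetherian and reduced it is semisimple.
  have hmin : ∀ P : Ideal Q, P.IsPrime → P.comap (algebraMap A Q) ∈ minimalPrimes A := by
    intro P hP
    have hd := (IsLocalization.isPrime_iff_isPrime_disjoint (nonZeroDivisors A) Q P).1 hP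
    have hprime : (P.comap (algebraMap A Q)).IsPrime := hd.1
    by_contra hn
    have hle : ∀ q ∈ minimalPrimes A, ¬ P.comap (algebraMap A Q) ≤ q := by
      intro q hq hle
      have := hq.2 ⟨hprime, bot_le⟩ hle
      exact hn (le_antisymm hle this ▸ hq)
    obtain ⟨d, hd1, hd2⟩ := exists_mem_forall_notMem_minimalPrimes hle
    exact Set.disjoint_left.1 hd.2 (mem_nonZeroDivisors_iff_forall_notMem_minimalPrimes.2 hd2) hd1
  have : Ring.KrullDimLE 0 Q := by
    refine Ring.KrullDimLE.mk₀ fun P hP => ?_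
    obtain ⟨m, hm, hPm⟩ := P.exists_le_maximal hP.ne_top
    have h1 := (hmin m hm.isPrime).2 ⟨(hmin P hP).1.1, bot_le⟩ (Ideal.comap_mono hPm)
    have h2 : m ≤ P := by
      rw [← IsLocalization.map_under (nonZeroDivisors A) Q m,
        ← IsLocalization.map_under (nonZeroDivisors A) Q P]
      exact Ideal.map_mono h1
    exact le_antisymm hPm h2 ▸ hm
  have : IsArtinianRing Q := isArtinianRing_iff_isNoetherianRing_krullDimLE_zero.2 ⟨‹_›, ‹_›⟩
  exact IsArtinianRing.isSemisimpleRing_of_isReduced Q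

/-- A surjection onto a finite torsion-free module over a reduced Noetherian ring splits up to a
nonzerodivisor. -/
theorem exists_comp_eq_smul_id {A M N : Type*} [CommRing A] [IsNoetherianRing A] [IsReduced A]
    [AddCommGroup M] [Module A M] [Module.Finite A M] [AddCommGroup N] [Module A N]
    (htf : ∀ c ∈ nonZeroDivisors A, ∀ x : M, c • x = 0 → x = 0)
    (f : N →ₗ[A] M) (hf : Function.Surjective f) :
    ∃ c ∈ nonZeroDivisors A, ∃ h : M →ₗ[A] N, f ∘ₗ h = c • LinearMap.id := by
  let U := nonZeroDivisors A
  have := isSemisimpleRing_localization_nonZeroDivisors A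
  have := Module.finitePresentation_of_finite A M
  let ιM := LocalizedModule.mkLinearMap U M
  let ιN := LocalizedModule.mkLinearMap U N
  let fU : LocalizedModule U N →ₗ[Localization U] LocalizedModule U M := LocalizedModule.map U f
  have hfU : Function.Surjective fU := LocalizedModule.map_surjective U f hf
  have := Module.projective_of_isSemisimpleRing (Localization U) (LocalizedModule U M)
  obtain ⟨s, hs⟩ := Module.projective_lifting_property fU LinearMap.id hfU
  -- The section over the total ring of fractions descends once multiplied by a common denominator
  -- `c`.
  obtain ⟨h, c, hh⟩ := Module.FinitePresentation.exists_lift_of_isLocalizedModule U ιN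
    ((s.restrictScalars A) ∘ₗ ιM)
  refine ⟨c, c.2, h, LinearMap.ext fun x => ?_⟩
  have h1 : ιM (f (h x)) = ιM ((c : A) • x) := by
    have e1 : ιN (h x) = (c : A) • s (ιM x) := LinearMap.congr_fun hh x
    have e2 : ιM (f (h x)) = fU (ιN (h x)) := by
      simp [ιM, ιN, fU, LocalizedModule.map_mk]
    have e3 : fU (s (ιM x)) = ιM x := LinearMap.congr_fun hs _
    rw [e2, e1, ← algebraMap_smul (Localization U) (c : A) (s (ιM x)), map_smul, e3,
      algebraMap_smul, map_smul]
  obtain ⟨u, hu⟩ := IsLocalizedModule.exists_of_eq (S := U) h1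
  rw [← sub_eq_zero, ← smul_sub] at hu
  exact sub_eq_zero.1 (htf u u.2 _ hu)

theorem exists_isFrobSplittingElement {A : Type*} [CommRing A] [Algebra (ZMod p) A]
    [IsNoetherianRing A] [IsReduced A] (hA : IsFFinite p A) :
    ∃ c : A, IsFrobSplittingElement p c := by
  have hfin := hA.finite_one
  obtain ⟨n, f, hf⟩ := Module.Finite.exists_fin' A (FrobRoot p 1 A)
  obtain ⟨c, hc, h, hh⟩ := exists_comp_eq_smul_id (fun c hc x hx => by
    exact mem_nonZeroDivisors_iff.1 (pow_mem hc (p ^ 1)) |>.1 _ hx) f hf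
  have hdual : ∀ x, c • x = ∑ i, h x i • f (Pi.single i 1) := by
    intro x
    have := LinearMap.congr_fun hh x
    simp only [LinearMap.comp_apply, LinearMap.smul_apply, LinearMap.id_apply] at this
    rw [← this]
    conv_lhs => rw [pi_eq_sum_univ' (h x)]
    simp
  have hone : c ^ p = ∑ i, h (root p 1 1) i ^ p * (root p 1).symm (f (Pi.single i 1)) := by
    have h1 := congrArg (root p 1).symm (hdual (root p 1 1))
    rw [map_sum, smul_root, mul_one, pow_one] at h1
    refine h1.trans (Finset.sum_congr rfl fun i _ => ?_)
    rw [← (root p 1).apply_symm_apply (f (Pi.single i 1)), smul_root, pow_one]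
    rfl
  -- Read in `A`, the expansion of `c • 1^{1/p}` is `c ^ p = ∑ hᵢ(1) ^ p * bᵢ`. Using `hᵢ(1) ^ (p -
  -- 1) * bᵢ`, with `bᵢ` read in `A`, as coefficients of the `hᵢ` gives a map with value `c ^ p` at
  -- 1; the dual basis is rescaled by `c ^ (p - 1)` to match.
  refine ⟨c ^ p, pow_mem hc p, ?_, n, fun i => c ^ (p - 1) • f (Pi.single i 1),
    fun i => LinearMap.proj i ∘ₗ h, fun x => ?_⟩
  · refine ⟨∑ i, (h (root p 1 1) i ^ (p - 1) * (root p 1).symm (f (Pi.single i 1))) •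
      (LinearMap.proj i ∘ₗ h), ?_⟩
    rw [hone, LinearMap.sum_apply]
    refine Finset.sum_congr rfl fun i _ => ?_
    rw [LinearMap.smul_apply, LinearMap.comp_apply, LinearMap.proj_apply, smul_eq_mul,
      mul_right_comm, pow_sub_one_mul (Fact.out : p.Prime).ne_zero]
  · rw [← pow_sub_one_mul (Fact.out : p.Prime).ne_zero, mul_smul, hdual, Finset.smul_sum]
    exact Finset.sum_congr rfl fun i _ => smul_comm _ _ _

end FFinite

/-! ### Flat base change -/

section BaseChange

open FrobRoot

variable {p : ℕ} [Fact p.Prime] {A B : Type*} [CommRing A] [CommRing B] [Algebra (ZMod p) A]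
  [Algebra (ZMod p) B] [Algebra A B]

variable (p A B) in
/-- Every map `A^{1/p^e} → A` extends to `B^{1/p^e} → B`, and the `B`-module `B^{1/p^e}` is
generated by `A^{1/p^e}`. -/
structure IsFrobExtension : Prop where
  exists_extension : ∀ (e : ℕ) (φ : FrobRoot p e A →ₗ[A] A), ∃ Φ : FrobRoot p e B →ₗ[B] B,
    ∀ x, Φ (root p e (algebraMap A B x)) = algebraMap A B (φ (root p e x))
  span_eq_top : ∀ e : ℕ,
    Submodule.span B (Set.range fun x : A => root p e (algebraMap A B x)) = ⊤

/-- The restriction to `A^{1/p^e}` of a map `B^{1/p^e} → B`. -/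
def FrobRoot.restrictAlgebraMap {e : ℕ} (Φ : FrobRoot p e B →ₗ[B] B) : FrobRoot p e A →ₗ[A] B where
  toFun x := Φ (root p e (algebraMap A B ((root p e).symm x)))
  map_add' x y := by simp
  map_smul' r x := by
    change Φ (root p e (algebraMap A B (r ^ p ^ e * (root p e).symm x))) = _
    rw [map_mul, map_pow, map_root_pow_mul, RingHom.id_apply, Algebra.smul_def]

/-- By flatness `f` factors through a finite free `A`-module, whose coordinates supply the
functionals on `N`. -/
theorem LinearMap.apply_mem_span_algebraMap_dual {N : Type*} [AddCommGroup N] [Module A N]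
    [Module.FinitePresentation A N] [Module.Flat A B] (f : N →ₗ[A] B) (x : N) :
    f x ∈ Ideal.span {b : B | ∃ φ : N →ₗ[A] A, b = algebraMap A B (φ x)} := by
  obtain ⟨k, h₂, h₃, rfl⟩ := Module.Flat.exists_factorization_of_finitePresentation f
  rw [LinearMap.comp_apply, ← (Finsupp.univ_sum_single (h₂ x)), map_sum]
  refine Ideal.sum_mem _ fun i _ => ?_
  have : Finsupp.single i (h₂ x i) = (h₂ x i) • Finsupp.single i (1 : A) := by simp
  rw [this, map_smul, Algebra.smul_def]
  exact Ideal.mul_mem_right _ _ (Ideal.subset_span ⟨Finsupp.lapply i ∘ₗ h₂, rfl⟩)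

theorem IsFrobExtension.map_frobTraceIdeal (h : IsFrobExtension p A B) [IsNoetherianRing A]
    [Module.Flat A B] (hA : ∀ e, Module.Finite A (FrobRoot p e A)) (c : A) :
    frobTraceIdeal p (algebraMap A B c) = (frobTraceIdeal p c).map (algebraMap A B) := by
  apply le_antisymm
  · refine Ideal.span_le.2 ?_
    rintro _ ⟨e, Φ, rfl⟩
    have := hA e
    have := Module.finitePresentation_of_finite A (FrobRoot p e A)
    refine Ideal.span_le.2 ?_
      ((restrictAlgebraMap (A := A) Φ).apply_mem_span_algebraMap_dual (root p e c))
    rintro _ ⟨φ, rfl⟩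
    exact Ideal.mem_map_of_mem _ (Ideal.subset_span ⟨e, φ, rfl⟩)
  · rw [frobTraceIdeal, Ideal.map_span]
    refine Ideal.span_le.2 ?_
    rintro _ ⟨_, ⟨e, φ, rfl⟩, rfl⟩
    obtain ⟨Φ, hΦ⟩ := h.exists_extension e φ
    exact Ideal.subset_span ⟨e, Φ, (hΦ c).symm⟩

theorem IsFrobSplittingElement.map {c : A} (hc : IsFrobSplittingElement p c)
    (h : IsFrobExtension p A B) [Module.Flat A B] :
    IsFrobSplittingElement p (algebraMap A B c) where
  mem_nonZeroDivisors := by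
    rw [mem_nonZeroDivisors_iff_right]
    intro y hy
    refine (Module.Flat.isSMulRegular_of_nonZeroDivisors (M := B)
      hc.mem_nonZeroDivisors).right_eq_zero_of_smul ?_
    rw [Algebra.smul_def, mul_comm, hy]
  exists_map_one := by
    obtain ⟨φ, hφ⟩ := hc.exists_map_one
    obtain ⟨Φ, hΦ⟩ := h.exists_extension 1 φ
    exact ⟨Φ, by rw [← map_one (algebraMap A B), hΦ, hφ]⟩
  exists_dualBasis := by
    obtain ⟨n, b, φ, hb⟩ := hc.exists_dualBasis
    choose Φ hΦ using fun i => h.exists_extension 1 (φ i)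
    refine ⟨n, fun i => root p 1 (algebraMap A B ((root p 1).symm (b i))), Φ, fun x => ?_⟩
    have hx : x ∈ Submodule.span B (Set.range fun x : A => root p 1 (algebraMap A B x)) :=
      h.span_eq_top 1 ▸ trivial
    induction hx using Submodule.span_induction with
    | mem y hy =>
      obtain ⟨a, rfl⟩ := hy
      have h1 := congrArg (fun z => root p 1 (algebraMap A B ((root p 1).symm z)))
        (hb (root p 1 a))
      simp only [map_sum] at h1
      refine Eq.trans ?_ (h1.trans (Finset.sum_congr rfl fun i _ => ?_))
      · rw [smul_root, smul_root, AddEquiv.symm_apply_apply, map_mul (algebraMap A B),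
          map_pow (algebraMap A B)]
      · obtain ⟨b', hb'⟩ := (root p 1).surjective (b i)
        have hb'' : (root p 1).symm (b i) = b' := by rw [← hb', AddEquiv.symm_apply_apply]
        beta_reduce
        rw [hΦ, hb'', ← hb', smul_root, smul_root, AddEquiv.symm_apply_apply,
          map_mul (algebraMap A B), map_pow (algebraMap A B)]
    | zero => simp
    | add y z _ _ hy hz => simp [smul_add, add_smul, Finset.sum_add_distrib, hy, hz]
    | smul r y _ hy => simp [smul_comm _ r, hy, Finset.smul_sum, mul_smul]

/-- The trace ideal of `c ^ 3` is the test ideal, and remains so after base change. -/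
theorem IsFrobSplittingElement.isTestIdeal_map [IsNoetherianRing A] [IsNoetherianRing B]
    [Module.Flat A B] {c : A} (hc : IsFrobSplittingElement p c) (h : IsFrobExtension p A B)
    (hA : Module.Finite A (FrobRoot p 1 A)) {τ : Ideal A} (hτ : IsTestIdeal p τ) :
    IsTestIdeal p (τ.map (algebraMap A B)) := by
  rw [hτ.unique hc.isTestIdeal, ← h.map_frobTraceIdeal (FrobRoot.finite hA), map_pow]
  exact (hc.map h).isTestIdeal

/-! ### Localizations -/

variable (p) in
theorem isFrobExtension_of_isLocalization (U : Submonoid A) [IsLocalization U B] :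
    IsFrobExtension p A B where
  exists_extension e φ := by
    have hq : ∀ u : A, u ^ (p ^ e - 1) * u = u ^ p ^ e := fun u =>
      pow_sub_one_mul (pow_ne_zero e (Fact.out : p.Prime).ne_zero) u
    -- Characterizing `z` by all fractions `b = a / u ^ p ^ e` at once makes the extension well
    -- defined. From `b = a / u = u ^ (p ^ e - 1) a / u ^ p ^ e` the value is `φ(u ^ (p ^ e - 1) a)
    -- / u`.
    have key : ∀ b : B, ∃ z : B, ∀ (a : A) (u : U), algebraMap A B u ^ p ^ e * b = algebraMap A B a →
        algebraMap A B u * z = algebraMap A B (φ (root p e a)) := by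
      intro b
      obtain ⟨⟨a, u⟩, hau⟩ := IsLocalization.surj U b
      simp only at hau
      refine ⟨IsLocalization.mk' B (φ (root p e (u ^ (p ^ e - 1) * a))) u, fun a' u' h => ?_⟩
      rw [← (IsLocalization.map_units B u).mul_right_inj, mul_left_comm,
        IsLocalization.mul_mk'_eq_mk'_of_mul, mul_comm (u : A), IsLocalization.mk'_mul_cancel_right,
        ← map_mul, ← map_mul, ← map_root_pow_mul, ← map_root_pow_mul]
      have h2 : algebraMap A B (u' ^ p ^ e * (u ^ (p ^ e - 1) * a)) =
          algebraMap A B (u ^ p ^ e * a') := by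
        simp only [map_mul, map_pow]
        rw [← h, ← hau, ← map_pow, ← map_pow, ← map_pow, ← hq u, map_mul]
        ring
      obtain ⟨v, hv⟩ := (IsLocalization.eq_iff_exists U B).1 h2
      have h3 : ∀ x, algebraMap A B (φ (root p e (v ^ p ^ e * x))) =
        algebraMap A B v * algebraMap A B (φ (root p e x)) := by
        intro x; rw [map_root_pow_mul, map_mul]
      -- The equality holds after multiplying by `v`, hence by `v ^ p ^ e`, which passes through `φ`
      -- as `v`.
      rw [← (IsLocalization.map_units B v).mul_right_inj, ← h3, ← h3, ← hq v, mul_assoc, mul_assoc,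
        hv]
    choose Φ hΦ using key
    have hinj : ∀ {z w : B} (u : U), algebraMap A B u * z = algebraMap A B u * w → z = w :=
      fun u => (IsLocalization.map_units B u).mul_left_cancel
    have hden : ∀ b : B, ∃ (a : A) (u : U), algebraMap A B u ^ p ^ e * b = algebraMap A B a := by
      intro b
      obtain ⟨⟨a, u⟩, hau⟩ := IsLocalization.surj U b
      simp only at hau
      exact ⟨u ^ (p ^ e - 1) * a, u, by rw [map_mul, ← hau, ← map_pow, ← hq u, map_mul]; ring⟩
    refine ⟨linearMapMk p e (AddMonoidHom.mk' Φ fun b b' => ?_) fun r b => ?_, fun x => ?_⟩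
    · obtain ⟨a, u, h⟩ := hden b
      obtain ⟨a', u', h'⟩ := hden b'
      refine hinj (u * u') ?_
      have e1 : algebraMap A B (u * u' : U) ^ p ^ e * (b + b') =
          algebraMap A B (u' ^ p ^ e * a + u ^ p ^ e * a') := by
        simp only [Submonoid.coe_mul, map_mul, map_add, map_pow, ← h, ← h']; ring
      rw [hΦ _ _ _ e1, map_add, map_add, map_add, map_root_pow_mul, map_root_pow_mul, map_mul,
        map_mul, ← hΦ _ _ _ h, ← hΦ _ _ _ h', Submonoid.coe_mul, map_mul]
      ring
    · change Φ (r ^ p ^ e * b) = r * Φ b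
      obtain ⟨a, u, h⟩ := hden b
      obtain ⟨⟨s, v⟩, hv⟩ := IsLocalization.surj U r
      simp only at hv
      refine hinj (v * u) ?_
      have e1 : algebraMap A B (v * u : U) ^ p ^ e * (r ^ p ^ e * b) =
          algebraMap A B (s ^ p ^ e * a) := by
        simp only [Submonoid.coe_mul, map_mul, map_pow, ← h, ← hv]; ring
      rw [hΦ _ _ _ e1, map_root_pow_mul, map_mul, ← hΦ _ _ _ h, Submonoid.coe_mul, map_mul, ← hv]
      ring
    · refine hinj (1 : U) ((hΦ _ x 1 (by simp)).trans (by simp))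
  span_eq_top e := by
    rw [Submodule.eq_top_iff']
    intro x
    obtain ⟨⟨a, u⟩, hau⟩ := IsLocalization.surj U ((root p e).symm x)
    simp only at hau
    have : x = IsLocalization.mk' B 1 u • root p e (algebraMap A B (u ^ (p ^ e - 1) * a)) := by
      apply (root p e).symm.injective
      rw [smul_root, AddEquiv.symm_apply_apply, map_mul, ← hau, map_pow]
      have h1 : IsLocalization.mk' B 1 u * algebraMap A B u = 1 := by
        rw [IsLocalization.mk'_spec, map_one]
      have h2 := pow_sub_one_mul (pow_ne_zero e (Fact.out : p.Prime).ne_zero) (algebraMap A B u)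
      calc (root p e).symm x = (IsLocalization.mk' B 1 u * algebraMap A B u) ^ p ^ e *
            (root p e).symm x := by rw [h1, one_pow, one_mul]
        _ = _ := by rw [mul_pow, ← h2]; ring
    rw [this]
    exact Submodule.smul_mem _ _ (Submodule.subset_span ⟨_, rfl⟩)

theorem IsFrobExtension.finite (h : IsFrobExtension p A B) {e : ℕ}
    (hA : Module.Finite A (FrobRoot p e A)) : Module.Finite B (FrobRoot p e B) := by
  obtain ⟨n, s, hs⟩ := @Module.Finite.exists_fin _ _ _ _ _ hA
  obtain ⟨s, rfl⟩ : ∃ s' : Fin n → A, s = fun i => root p e (s' i) :=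
    ⟨fun i => (root p e).symm (s i), rfl⟩
  rw [exists_generators_iff] at hs
  have key : ⊤ ≤ Submodule.span B (Set.range fun i => root p e (algebraMap A B (s i))) := by
    rw [← h.span_eq_top e, Submodule.span_le]
    rintro _ ⟨x, rfl⟩
    obtain ⟨a, rfl⟩ := hs x
    simp only [map_sum, map_mul, map_pow, ← smul_root]
    exact Submodule.sum_mem _ fun i _ =>
      Submodule.smul_mem _ _ (Submodule.subset_span ⟨i, rfl⟩)
  exact ⟨⟨(Set.finite_range _).toFinset, by simpa using top_le_iff.1 key⟩⟩

end BaseChange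

/-! ### Adic completions -/

section Completion

open FrobRoot

/-- Finite products of precomplete rings are precomplete. -/
theorem IsPrecomplete.pi {B ι : Type*} [CommRing B] [Finite ι] (J : Ideal B)
    [IsPrecomplete J B] : IsPrecomplete J (ι → B) := by
  classical
  cases nonempty_fintype ι
  have hle : ∀ (n : ℕ) (v : ι → B), v ∈ (J ^ n • ⊤ : Submodule B (ι → B)) ↔ ∀ i, v i ∈ J ^ n := by
    intro n v
    constructor
    · intro hv i
      induction hv using Submodule.smul_induction_on' with
      | smul r hr w _ => exact Ideal.mul_mem_right _ _ hr
      | add v _ w _ h1 h2 => exact Ideal.add_mem _ h1 h2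
    · intro hv
      rw [pi_eq_sum_univ' v]
      exact Submodule.sum_mem _ fun i _ => Submodule.smul_mem_smul (hv i) trivial
  refine ⟨fun f hf => ?_⟩
  have h1 : ∀ i, ∃ L : B, ∀ n, f n i ≡ L [SMOD (J ^ n • ⊤ : Submodule B B)] := by
    intro i
    refine IsPrecomplete.prec' (fun n => f n i) fun {m n} hmn => ?_
    have := hf hmn
    rw [SModEq.sub_mem, hle] at this
    rw [SModEq.sub_mem, smul_eq_mul, Ideal.mul_top]
    exact this i
  choose L hL using h1
  refine ⟨L, fun n => ?_⟩
  rw [SModEq.sub_mem, hle]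
  intro i
  have := hL i n
  rwa [SModEq.sub_mem, smul_eq_mul, Ideal.mul_top] at this

variable {p : ℕ} [Fact p.Prime] {A B : Type*} [CommRing A] [CommRing B] [Algebra (ZMod p) A]
  [Algebra (ZMod p) B] [Algebra A B]

variable (p) in
theorem Ideal.exists_pow_le_map_frobIter {I : Ideal A} (hI : I.FG) (e : ℕ) :
    ∃ k, 0 < k ∧ I ^ k ≤ I.map (frobIter p e A) := by
  obtain ⟨k, hk⟩ := Ideal.exists_pow_le_of_le_radical_of_fg (I := I) (J := I.map (frobIter p e A))
    (fun x hx => ⟨p ^ e, Ideal.mem_map_of_mem (frobIter p e A) hx⟩) hI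
  exact ⟨k + 1, k.succ_pos, (Ideal.pow_le_pow_right k.le_succ).trans hk⟩

theorem map_root_mem_of_mem_map_frobIter {e : ℕ} (φ : FrobRoot p e A →ₗ[A] A) {I : Ideal A} {x : A}
    (hx : x ∈ I.map (frobIter p e A)) : φ (root p e x) ∈ I := by
  refine map_root_mem_of_mem_span φ ?_ hx
  rintro a _ ⟨y, hy, rfl⟩
  change φ (root p e (a * y ^ p ^ e)) ∈ I
  rw [mul_comm, map_root_pow_mul]
  exact I.mul_mem_right _ hy

theorem root_mem_smul_top_iff {e : ℕ} {I : Ideal A} {x : A} :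
    root p e x ∈ (I • ⊤ : Submodule A (FrobRoot p e A)) ↔ x ∈ I.map (frobIter p e A) := by
  constructor
  · intro hx
    suffices H : ∀ y ∈ (I • ⊤ : Submodule A (FrobRoot p e A)),
        (root p e).symm y ∈ I.map (frobIter p e A) from H _ hx
    intro y hy
    induction hy using Submodule.smul_induction_on' with
    | smul r hr w _ => exact Ideal.mul_mem_right _ _ (Ideal.mem_map_of_mem (frobIter p e A) hr)
    | add v _ w _ h1 h2 => exact Ideal.add_mem _ h1 h2
  · intro hx
    suffices H : ∀ a, root p e (a * x) ∈ (I • ⊤ : Submodule A (FrobRoot p e A)) by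
      simpa using H 1
    induction hx using Submodule.span_induction with
    | mem y hy =>
      obtain ⟨z, hz, rfl⟩ := hy
      intro a
      change root p e (a * z ^ p ^ e) ∈ _
      rw [mul_comm, ← smul_root]
      exact Submodule.smul_mem_smul hz trivial
    | zero => intro a; simp
    | add y z _ _ hy hz => intro a; rw [mul_add, map_add]; exact Submodule.add_mem _ (hy a) (hz a)
    | smul b y _ hy => intro a; simpa [mul_assoc] using hy (a * b)

/-- A complete ring in which `A` is dense, with the adic topology induced, is Frobenius-extended
from `A`. -/
theorem isFrobExtension_of_isAdicComplete {I : Ideal A} (hI : I.FG)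
    (hA : ∀ e, Module.Finite A (FrobRoot p e A))
    [hB : IsAdicComplete (I.map (algebraMap A B)) B]
    (hdense : ∀ (n : ℕ) (b : B), ∃ a, b - algebraMap A B a ∈ I.map (algebraMap A B) ^ n)
    (hsep : ∀ (n : ℕ) (a : A), algebraMap A B a ∈ I.map (algebraMap A B) ^ n → a ∈ I ^ n) :
    IsFrobExtension p A B where
  exists_extension e φ := by
    set J := I.map (algebraMap A B) with hJ
    obtain ⟨k, hk0, hk⟩ := Ideal.exists_pow_le_map_frobIter p hI e
    -- Continuity of `φ`: `I ^ (k n)` lies in the Frobenius power of `I ^ n`, which `φ` maps into `I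
    -- ^ n`.
    have hφ : ∀ n a, algebraMap A B a ∈ J ^ (k * n) → algebraMap A B (φ (root p e a)) ∈ J ^ n := by
      intro n a ha
      have h1 : a ∈ (I ^ n).map (frobIter p e A) := by
        rw [Ideal.map_pow]
        have := hsep _ _ ha
        rw [pow_mul] at this
        exact Ideal.pow_right_mono hk n this
      rw [hJ, ← Ideal.map_pow]
      exact Ideal.mem_map_of_mem _ (map_root_mem_of_mem_map_frobIter φ h1)
    have hzero : ∀ z : B, (∀ n, z ∈ J ^ n) → z = 0 := by
      intro z hz
      refine hB.toIsHausdorff.haus' z fun n => ?_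
      rw [SModEq.zero, smul_eq_mul, Ideal.mul_top]
      exact hz n
    -- The value at `b` is the limit of `φ` along approximations of `b` in `A`; the stated estimate
    -- for every approximation determines it.
    have key : ∀ b : B, ∃ z : B, ∀ n a, b - algebraMap A B a ∈ J ^ (k * n) →
        z - algebraMap A B (φ (root p e a)) ∈ J ^ n := by
      intro b
      choose s hs using fun n => hdense (k * n) b
      have hdiff : ∀ n a, b - algebraMap A B a ∈ J ^ (k * n) → ∀ m, n ≤ m →
          algebraMap A B (φ (root p e (s m))) - algebraMap A B (φ (root p e a)) ∈ J ^ n := by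
        intro n a ha m hnm
        rw [← map_sub, ← map_sub, ← map_sub]
        refine hφ _ _ ?_
        rw [map_sub]
        have h1 := Ideal.sub_mem _ ha (Ideal.pow_le_pow_right (Nat.mul_le_mul_left k hnm) (hs m))
        convert h1 using 1
        ring
      obtain ⟨z, hz⟩ := hB.toIsPrecomplete.prec' (fun n => algebraMap A B (φ (root p e (s n))))
        fun {m n} hmn => by
          rw [SModEq.sub_mem, smul_eq_mul, Ideal.mul_top]
          have := Ideal.neg_mem_iff _ |>.2 (hdiff m (s m) (hs m) n hmn)
          rwa [neg_sub] at this
      refine ⟨z, fun n a ha => ?_⟩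
      have h1 := hz n
      rw [SModEq.sub_mem, smul_eq_mul, Ideal.mul_top] at h1
      have h2 := Ideal.sub_mem _ (hdiff n a ha n le_rfl) h1
      convert h2 using 1
      ring
    choose Φ hΦ using key
    refine ⟨linearMapMk p e (AddMonoidHom.mk' Φ fun b b' => ?_) fun r b => ?_, fun x => ?_⟩
    · rw [← sub_eq_zero]
      refine hzero _ fun n => ?_
      obtain ⟨a, ha⟩ := hdense (k * n) b
      obtain ⟨a', ha'⟩ := hdense (k * n) b'
      have h1 : b + b' - algebraMap A B (a + a') ∈ J ^ (k * n) := by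
        convert Ideal.add_mem _ ha ha' using 1
        rw [map_add]; ring
      have h2 := Ideal.sub_mem _ (hΦ _ n _ h1) (Ideal.add_mem _ (hΦ _ n _ ha) (hΦ _ n _ ha'))
      convert h2 using 1
      simp only [map_add]; ring
    · change Φ (r ^ p ^ e * b) = r * Φ b
      rw [← sub_eq_zero]
      refine hzero _ fun n => ?_
      obtain ⟨a, ha⟩ := hdense (k * n) b
      obtain ⟨s, hs⟩ := hdense (k * n) r
      have hs' : r - algebraMap A B s ∈ J ^ n :=
        Ideal.pow_le_pow_right (Nat.le_mul_of_pos_left n hk0) hs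
      have h1 : r ^ p ^ e * b - algebraMap A B (s ^ p ^ e * a) ∈ J ^ (k * n) := by
        obtain ⟨t, ht⟩ := sub_dvd_pow_sub_pow r (algebraMap A B s) (p ^ e)
        have e1 : r ^ p ^ e * b - algebraMap A B (s ^ p ^ e * a) =
            (r - algebraMap A B s) * (t * b) + algebraMap A B s ^ p ^ e * (b - algebraMap A B a) := by
          rw [← mul_assoc, ← ht, map_mul, map_pow]; ring
        rw [e1]
        exact Ideal.add_mem _ (Ideal.mul_mem_right _ _ hs) (Ideal.mul_mem_left _ _ ha)
      have h2 := hΦ _ n _ h1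
      rw [map_root_pow_mul, map_mul] at h2
      have h3 := Ideal.add_mem _ (Ideal.mul_mem_left _ r (hΦ _ n _ ha))
        (Ideal.mul_mem_right (algebraMap A B (φ (root p e a))) _ hs')
      convert Ideal.sub_mem _ h2 h3 using 1
      ring
    · change Φ _ = _
      rw [← sub_eq_zero]
      exact hzero _ fun n => hΦ _ n _ (by simp)
  span_eq_top e := by
    set J := I.map (algebraMap A B) with hJ
    have hJfg : J.FG := hI.map _
    obtain ⟨n, g, hg⟩ := @Module.Finite.exists_fin _ _ _ _ _ (hA e)
    obtain ⟨g, rfl⟩ : ∃ g' : Fin n → A, g = fun i => root p e (g' i) :=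
      ⟨fun i => (root p e).symm (g i), rfl⟩
    rw [exists_generators_iff] at hg
    let f : (Fin n → B) →ₗ[B] FrobRoot p e B :=
      Fintype.linearCombination B fun i => root p e (algebraMap A B (g i))
    have : IsPrecomplete J (Fin n → B) := IsPrecomplete.pi J
    have : IsHausdorff J (FrobRoot p e B) := by
      refine ⟨fun x hx => ?_⟩
      apply (root p e).symm.injective
      rw [map_zero]
      refine hB.toIsHausdorff.haus' _ fun n => ?_
      have h1 := hx n
      rw [SModEq.zero, ← (root p e).apply_symm_apply x, root_mem_smul_top_iff] at h1
      rw [SModEq.zero, smul_eq_mul, Ideal.mul_top]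
      refine (Ideal.map_le_iff_le_comap.2 fun y hy => ?_ : (J ^ n).map (frobIter p e B) ≤ J ^ n) h1
      exact Ideal.pow_mem_of_mem _ hy _ (pow_pos (Fact.out : p.Prime).pos e)
    -- Complete Nakayama: source precomplete and target separated, so surjectivity modulo `J`
    -- suffices. There, density replaces `y` by an element of `A`, which the `g i` generate.
    have hf : Function.Surjective f := by
      refine surjective_of_mkQ_comp_surjective (I := J) fun y => ?_
      obtain ⟨y, rfl⟩ := Submodule.mkQ_surjective _ y
      obtain ⟨y, rfl⟩ := (root p e).surjective y
      obtain ⟨k, -, hk⟩ := Ideal.exists_pow_le_map_frobIter p hJfg e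
      obtain ⟨a, ha⟩ := hdense k y
      obtain ⟨r, hr⟩ := hg a
      refine ⟨fun i => algebraMap A B (r i), ?_⟩
      rw [LinearMap.comp_apply, ← sub_eq_zero, ← map_sub, ← neg_eq_zero, ← map_neg, neg_sub,
        Submodule.mkQ_apply, Submodule.Quotient.mk_eq_zero]
      have : f (fun i => algebraMap A B (r i)) = root p e (algebraMap A B a) := by
        simp only [f, Fintype.linearCombination_apply, smul_root, hr, map_sum, map_mul, map_pow]
      rw [this, ← map_sub, root_mem_smul_top_iff]
      exact hk ha
    rw [Submodule.eq_top_iff']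
    intro y
    obtain ⟨v, rfl⟩ := hf y
    simp only [f, Fintype.linearCombination_apply]
    exact Submodule.sum_mem _ fun i _ => Submodule.smul_mem _ _ (Submodule.subset_span ⟨g i, rfl⟩)

/-! ### Noetherianity of the completion -/

namespace AdicCompletion

variable {A : Type*} [CommRing A] {I : Ideal A}

theorem mem_map_algebraMap_pow_iff (hI : I.FG) (n : ℕ) (b : AdicCompletion I A) :
    b ∈ I.map (algebraMap A (AdicCompletion I A)) ^ n ↔ eval I A n b = 0 := by
  rw [← LinearMap.mem_ker, ← pow_smul_top_eq_ker_eval hI, Ideal.smul_top_eq_map, Ideal.map_pow,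
    Submodule.restrictScalars_mem]

theorem exists_sub_algebraMap_mem (hI : I.FG) (n : ℕ) (b : AdicCompletion I A) :
    ∃ a, b - algebraMap A (AdicCompletion I A) a ∈
      I.map (algebraMap A (AdicCompletion I A)) ^ n := by
  obtain ⟨a, ha⟩ := Submodule.mkQ_surjective _ (eval I A n b)
  refine ⟨a, ?_⟩
  rw [mem_map_algebraMap_pow_iff hI, map_sub, sub_eq_zero, ← ha]
  rfl

theorem mem_pow_of_algebraMap_mem (hI : I.FG) (n : ℕ) (a : A)
    (ha : algebraMap A (AdicCompletion I A) a ∈ I.map (algebraMap A (AdicCompletion I A)) ^ n) :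
    a ∈ I ^ n := by
  rw [mem_map_algebraMap_pow_iff hI] at ha
  have : (Submodule.mkQ (I ^ n • ⊤ : Submodule A A)) a = 0 := ha
  rwa [Submodule.mkQ_apply, Submodule.Quotient.mk_eq_zero, smul_eq_mul, Ideal.mul_top] at this

/-- The adic completion of a Noetherian ring is Noetherian. -/
theorem isNoetherianRing (A : Type*) [CommRing A] [IsNoetherianRing A] (I : Ideal A) :
    IsNoetherianRing (AdicCompletion I A) := by
  have hI : I.FG := I.fg_of_isNoetherianRing
  obtain ⟨n, g, hg⟩ := Submodule.fg_iff_exists_fin_generating_family.1 hI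
  let P := MvPolynomial (Fin n) A
  let J : Ideal P := MvPolynomial.idealOfVars (Fin n) A
  have hJfg : J.FG := Submodule.fg_span (Set.finite_range _)
  let ev : P →+* A := (MvPolynomial.aeval g).toRingHom
  have hJI : J.map ev = I := by
    rw [← hg]
    simp only [J, MvPolynomial.idealOfVars, Ideal.map_span, ← Set.range_comp]
    congr 2
    ext i
    exact MvPolynomial.aeval_X g i
  have hle (m : ℕ) : J ^ m ≤ (I ^ m).comap ev := by
    rw [← Ideal.map_le_iff_le_comap, Ideal.map_pow, hJI]
  let f (m : ℕ) : AdicCompletion J P →+* A ⧸ I ^ m :=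
    (Ideal.quotientMap (I ^ m) ev (hle m)).comp (evalₐ J m).toRingHom
  -- Sending the variables to generators of `I` exhibits the completion as a quotient of a power
  -- series ring over `A`.
  let F : AdicCompletion J P →+* AdicCompletion I A := liftRingHom I f (by
    intro m n hmn
    refine RingHom.ext fun x => ?_
    obtain ⟨a, rfl⟩ := mk_surjective J P x
    change Ideal.Quotient.factorPow I hmn (Ideal.quotientMap (I ^ n) ev (hle n) (evalₐ J n (mk J P a))) =
      Ideal.quotientMap (I ^ m) ev (hle m) (evalₐ J m (mk J P a))
    rw [evalₐ_mk, evalₐ_mk, Ideal.quotientMap_mk, ← Ideal.mk_eq_mk J hmn a, Ideal.quotientMap_mk]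
    rfl)
  have hF : F.comp (algebraMap P _) = (algebraMap A _).comp ev := by
    refine RingHom.ext fun x => ext_evalₐ fun m => ?_
    rw [RingHom.comp_apply, evalₐ_liftRingHom, RingHom.comp_apply]
    change Ideal.quotientMap _ ev (hle m) (evalₐ J m (of J P x)) = evalₐ I m (of I A (ev x))
    rw [evalₐ_of, evalₐ_of, Ideal.quotientMap_mk]
  have hmap : (J.map (algebraMap P (AdicCompletion J P))).map F =
      I.map (algebraMap A (AdicCompletion I A)) := by
    rw [Ideal.map_map, hF, ← Ideal.map_map, hJI]
  have : IsAdicComplete (J.map (algebraMap P (AdicCompletion J P))) (AdicCompletion J P) :=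
    isAdicComplete_self J hJfg
  have h2 : IsAdicComplete (I.map (algebraMap A (AdicCompletion I A))) (AdicCompletion I A) :=
    isAdicComplete_self I hI
  rw [← hmap] at h2
  have hsurj : Function.Surjective F := by
    refine surjective_of_mk_map_comp_surjective (I := J.map (algebraMap P (AdicCompletion J P))) F
      fun y => ?_
    obtain ⟨y, rfl⟩ := Ideal.Quotient.mk_surjective y
    obtain ⟨a, ha⟩ := exists_sub_algebraMap_mem hI 1 y
    refine ⟨algebraMap P _ (MvPolynomial.C a), ?_⟩
    rw [RingHom.comp_apply, eq_comm, Ideal.Quotient.eq, hmap]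
    have : F (algebraMap P _ (MvPolynomial.C a)) = algebraMap A _ a := by
      exact (RingHom.congr_fun hF (MvPolynomial.C a)).trans
        (congrArg (algebraMap A (AdicCompletion I A)) (MvPolynomial.aeval_C g a))
    rwa [this, ← pow_one (I.map _)]
  have : IsNoetherianRing (AdicCompletion J P) :=
    isNoetherianRing_of_ringEquiv _
      (MvPowerSeries.toAdicCompletionAlgEquiv (Fin n) A).toRingEquiv
  exact isNoetherianRing_of_surjective _ _ F hsurj

end AdicCompletion

end Completion

/-! ### The main theorem -/

theorem mainTheorem9 (p : ℕ) [Fact p.Prime] (R : Type*) [CommRing R] [Algebra (ZMod p) R]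
    [IsNoetherianRing R] [IsReduced R] (hF : IsFFinite p R) :
    ∃ τ : Ideal R, IsTestIdeal p τ ∧
      (∀ U : Submonoid R,
        IsTestIdeal p (τ.map (algebraMap R (Localization U)))) ∧
      (∀ (P : Ideal R) [P.IsPrime],
        IsTestIdeal p ((τ.map (algebraMap R (Localization.AtPrime P))).map
          (algebraMap (Localization.AtPrime P) (LocalCompletion P)))) ∧
      (IsFRegular p R ↔ τ = ⊤) ∧
      (PrimeSpectrum.zeroLocus (τ : Set R) =
        {P : PrimeSpectrum R | ¬ IsFRegular p (Localization.AtPrime P.asIdeal)}) ∧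
      (∀ c : R, IsUniformlyFCompatible p (frobTraceIdeal p c)) ∧
      (∃ c ∈ τ, ∀ P ∈ minimalPrimes R, c ∉ P) ∧
      (∀ c ∈ τ, (∀ P ∈ minimalPrimes R, c ∉ P) → frobTraceIdeal p c = τ) := by
  obtain ⟨c, hc⟩ := exists_isFrobSplittingElement hF
  have hfin := hF.finite_one
  have hτ := hc.isTestIdeal
  set τ := frobTraceIdeal p (c ^ 3)
  have hext (U : Submonoid R) : IsFrobExtension p R (Localization U) :=
    isFrobExtension_of_isLocalization p U
  have hnoeth (U : Submonoid R) : IsNoetherianRing (Localization U) :=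
    IsLocalization.isNoetherianRing U _ inferInstance
  have hflat (U : Submonoid R) : Module.Flat R (Localization U) := IsLocalization.flat _ U
  have hloc (U : Submonoid R) : IsTestIdeal p (τ.map (algebraMap R (Localization U))) :=
    hc.isTestIdeal_map (hext U) hfin hτ
  refine ⟨τ, hτ, hloc, ?_, hc.isFRegular_iff hτ, ?_, isUniformlyFCompatible_frobTraceIdeal,
    exists_mem_forall_notMem_minimalPrimes hτ.1.2,
    fun d hd hdm => frobTraceIdeal_eq_of_isTestIdeal hτ hd hdm⟩
  · intro P _
    let S := Localization.AtPrime P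
    have hcS := hc.map (hext P.primeCompl)
    have : IsNoetherianRing S := hnoeth P.primeCompl
    have hfinS : Module.Finite S (FrobRoot p 1 S) := (hext P.primeCompl).finite hfin
    have hI := (IsLocalRing.maximalIdeal S).fg_of_isNoetherianRing
    have : IsNoetherianRing (LocalCompletion P) := AdicCompletion.isNoetherianRing S _
    have := AdicCompletion.isAdicComplete_self _ hI
    exact hcS.isTestIdeal_map (isFrobExtension_of_isAdicComplete hI (FrobRoot.finite hfinS)
      (AdicCompletion.exists_sub_algebraMap_mem hI) (AdicCompletion.mem_pow_of_algebraMap_mem hI))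
      hfinS (hloc P.primeCompl)
  -- F-regularity of `R_P` means `τ R_P = R_P`, which fails exactly when `τ` is disjoint from the
  -- complement of `P`.
  · ext P
    have := hnoeth P.asIdeal.primeCompl
    have := hflat P.asIdeal.primeCompl
    rw [PrimeSpectrum.mem_zeroLocus, Set.mem_ofPred_eq, SetLike.coe_subset_coe,
      (hc.map (hext P.asIdeal.primeCompl)).isFRegular_iff (hloc P.asIdeal.primeCompl),
      ← ne_eq, IsLocalization.map_algebraMap_ne_top_iff_disjoint P.asIdeal.primeCompl, disjoint_comm]
    simp [Set.disjoint_left, SetLike.le_def, Ideal.primeCompl]
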